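/- **Setting.** Consider $n$ qubits, with Hilbert space $(\mathbb C^2)^{\otimes n}$; $\|\cdot\|$ is the operator norm. An operator is *$k$-local* if it is a finite sum of operators each of which acts non-trivially on at most $k$ qubits. For $k\in\mathbb N$ and $\epsilon>0$, an operator $Q$ is *$(k,\epsilon)$-local* if there is a $k$-local operator $R$ (not necessarily a state) with $\|Q-R\|\le\epsilon$. An *$\ell$-local commuting Hamiltonian* is a self-adjoint operator $H=\sum_j H_j$ given as a finite sum of pairwise commuting operators $H_j$, each acting non-trivially on at most $\ell$ qubits; for $S\subseteq[n]$, $H_S$ denotes the sum of those $H_j$ that act non-trivially on at least one qubit in $S$. Given $\ell$-local commuting Hamiltonians $H^{(1)},\dots,H^{(p)}$ (different $H^{(i)}$ need not commute with each other) and a pure product state $\rho_0=\bigotimes_{i=1}^n|\varphi_i\rangle\langle\varphi_i|$, put $U_i=e^{-\mathrm i H^{(i)}}$ and $$\rho_p=\big(U_p\cdots U_1\big)\,\rho_0\,\big(U_1^\dagger\cdots U_p^\dagger\big),$$ the output state of the level-$p$ dense Hamiltonian evolution. **Theorem 4.1.** For every $\ell\in\mathbb N$ and $\tilde C>0$ there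 is a constant $c_1>0$ such that for every $\alpha\in[0,1)$ and every function $p=p(n)\in\mathbb N$ with $p(n)=o(\log n)$ the following holds for all sufficiently large $n$. Let $H^{(1)},\dots,H^{(p)}$ be $\ell$-local commuting Hamiltonians on $n$ qubits such that $$\|H^{(i)}_S\|\le\tilde C\,n^{\alpha}|S|^{1-\alpha}\qquad\text{for every } i \text{ and every } S\subseteq[n],$$ and let $\rho_0$ be a pure product state of $n$ qubits. Then $\rho_p$ is $(k_p,\epsilon_p)$-local for some $k_p\in\mathbb N$ and $\epsilon_p>0$ with $$k_p\le c_1^{\,p}\,n^{1-(1-\alpha)^p/4},\qquad \epsilon_p\le 4\,e^{-n^{1/8}/\sqrt2}.$$ -/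

import Mathlib

open Filter Asymptotics
open scoped Matrix Matrix.Norms.L2Operator

namespace DenseEvolution

/-- Computational basis labels of `n` qubits. -/
abbrev Basis (n : ℕ) : Type := Fin n → Fin 2

/-- Linear operators on the Hilbert space `(ℂ²)^{⊗ n}`, written as matrices in the computational
basis. With `Matrix.Norms.L2Operator` open, `‖A‖` is the operator norm induced by the Euclidean
norm (the largest singular value). -/
abbrev Op (n : ℕ) : Type := Matrix (Basis n) (Basis n) ℂ

/-- `A` acts trivially on qubit `q`: it has the form `1_q ⊗ B`, where `B` is an operator on the
remaining qubits. -/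
def ActsTriviallyOn {n : ℕ} (A : Op n) (q : Fin n) : Prop :=
  ∃ B : Matrix ({j : Fin n // j ≠ q} → Fin 2) ({j : Fin n // j ≠ q} → Fin 2) ℂ,
    ∀ x y : Basis n, A x y = if x q = y q then B (fun j => x j) (fun j => y j) else 0

open Classical in
/-- The set of qubits on which `A` acts non-trivially. -/
noncomputable def qubitSupport {n : ℕ} (A : Op n) : Finset (Fin n) :=
  Finset.univ.filter fun q => ¬ ActsTriviallyOn A q

/-- A `k`-local operator: a (finite) sum of operators each of which acts non-trivially on at most
`k` qubits. -/
def IsLocal {n : ℕ} (k : ℕ) (R : Op n) : Prop :=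
  ∃ (m : ℕ) (T : Fin m → Op n), (∀ i, (qubitSupport (T i)).card ≤ k) ∧ R = ∑ i, T i

/-- A `(k, ε)`-local operator: one within operator-norm distance `ε` of a `k`-local operator. -/
def IsApproxLocal {n : ℕ} (k : ℕ) (ε : ℝ) (Q : Op n) : Prop :=
  ∃ R : Op n, IsLocal k R ∧ ‖Q - R‖ ≤ ε

/-- An `ℓ`-local commuting Hamiltonian on `n` qubits, together with its local decomposition: a
finite family of pairwise commuting operators, each acting non-trivially on at most `ℓ` qubits,
whose sum is self-adjoint. (This includes the case where every term is self-adjoint.) -/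
structure CommutingLocalHamiltonian (n ℓ : ℕ) where
  numTerms : ℕ
  term : Fin numTerms → Op n
  card_qubitSupport_le : ∀ i, (qubitSupport (term i)).card ≤ ℓ
  commute : ∀ i j, Commute (term i) (term j)
  isHermitian : (∑ i, term i).IsHermitian

namespace CommutingLocalHamiltonian

variable {n ℓ : ℕ}

/-- The Hamiltonian itself, the sum of its local terms. -/
noncomputable def op (H : CommutingLocalHamiltonian n ℓ) : Op n := ∑ i, H.term i

/-- The subset Hamiltonian `H_S`: the sum of all local terms which act non-trivially on at least
one qubit in `S`. -/
noncomputable def subsetOp (H : CommutingLocalHamiltonian n ℓ) (S : Finset (Fin n)) : Op n :=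
  ∑ i with (qubitSupport (H.term i) ∩ S).Nonempty, H.term i

/-- The norm constraint `‖H_S‖ ≤ C n^α |S|^(1-α)` for every set `S` of qubits. -/
def NormConstraint (H : CommutingLocalHamiltonian n ℓ) (α C : ℝ) : Prop :=
  ∀ S : Finset (Fin n), ‖H.subsetOp S‖ ≤ C * (n : ℝ) ^ α * (S.card : ℝ) ^ (1 - α)

/-- The unitary `e^{-iH}`. -/
noncomputable def unitary (H : CommutingLocalHamiltonian n ℓ) : Op n :=
  NormedSpace.exp ((-Complex.I) • H.op)

end CommutingLocalHamiltonian

/-- The dense Hamiltonian evolution `U_p ⋯ U_1` of level `p`, where `U_i = e^{-iH⁽ⁱ⁾}`; the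
Hamiltonians are indexed from `0`, and `H 0` is applied first. -/
noncomputable def evolution {n ℓ : ℕ} :
    (p : ℕ) → (Fin p → CommutingLocalHamiltonian n ℓ) → Op n
  | 0, _ => 1
  | p + 1, H => (H (Fin.last p)).unitary * evolution p fun i => H i.castSucc

/-- `ρ` is a pure product state `|ψ⟩⟨ψ|` with `|ψ⟩ = ⊗ᵢ |φᵢ⟩` for unit vectors `φᵢ ∈ ℂ²`. -/
def IsPureProductState {n : ℕ} (ρ : Op n) : Prop :=
  ∃ φ : Fin n → EuclideanSpace ℂ (Fin 2), (∀ i, ‖φ i‖ = 1) ∧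
    ∀ x y : Basis n, ρ x y = (∏ i, φ i (x i)) * star (∏ i, φ i (y i))

/-- The output `(U_p ⋯ U_1) ρ₀ (U_1† ⋯ U_p†)` of the dense Hamiltonian evolution. -/
noncomputable def outputState {n ℓ p : ℕ} (H : Fin p → CommutingLocalHamiltonian n ℓ)
    (ρ₀ : Op n) : Op n :=
  evolution p H * ρ₀ * (evolution p H)ᴴ

end DenseEvolution

/-!
The locality of `ρ_p` is propagated through one step `R ↦ e^{-iH} R e^{iH}` at a time, by a
Bernstein-type argument that does not depend on how many local terms `R` has.

Let `R` be `k`-local and consider the entire function `F(z) = e^{zH} R e^{-zH}` (`conjFlow`). For a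
single operator `T` on `k` qubits only the terms of `H` that touch the support `S` of `T` matter, so
`‖e^{zH} T e^{-zH}‖ ≤ ‖T‖ e^{2‖H_S‖|z|}`, and the norm constraint gives `‖H_S‖ ≤ C n^α k^{1-α}`.
Summing over the terms of `R` shows that `F` has exponential type `B = 2 C n^α k^{1-α}` along the
real axis, with an uncontrolled constant. On the imaginary axis the flow is unitary, so `‖F‖ = ‖R‖`
there. The Phragmén–Lindelöf principle removes the constant: `‖F(z)‖ ≤ ‖R‖ e^{B|z|}` on the whole
plane (`norm_conjFlow_le_of_isLocal`). Cauchy's estimates on the circle of radius `e²` then show that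
the Taylor polynomial of `F` at `0` of degree `d ≥ e² B`, evaluated at `-i`, approximates
`e^{-iH} R e^{iH}` up to `‖R‖ e^{-d}` (`norm_sub_taylor_le`). The Taylor coefficients are iterated
commutators with `H` divided by factorials, and each commutator with `H` enlarges supports by at
most `ℓ` qubits, so the approximation is `(k + d ℓ)`-local (`isApproxLocal_unitary_conj`). No term of
`H` has to be self-adjoint for this, only the sum.

A pure product state is the spectral projector at `0` of a `1`-local operator with spectrum in
`{0, …, n}`, the weight operator of an adapted product basis. A rescaled Chebyshev polynomial of
degree `⌊n^{3/4}⌋` approximates the indicator of `0` on this set up to about `2 e^{-n^{1/4}}`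
(`IsPureProductState.isApproxLocal`).

With `d` of the order of `c^p n^{1-(1-α)^{p+1}/4}`, the recursion `k ↦ k + d ℓ` yields the claimed
range, since `n^α k^{1-α}` maps the exponent `1 - (1-α)^p/4` to `1 - (1-α)^{p+1}/4`
(`exists_isApproxLocal_outputState`). Each step adds at most `2 e^{-n^{3/4}}` to the error, and
`p = o(log n)` gives `p ≤ n` eventually, so the total stays negligible.
-/

namespace DenseEvolution

/-! ### Entire functions of exponential type bounded on the imaginary axis -/

section EntireFunctions

variable {E : Type*} [NormedAddCommGroup E] [NormedSpace ℂ E]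

theorem norm_le_mul_exp_re_of_nonneg {f : ℂ → E} (hf : Differentiable ℂ f) {A B K L M : ℝ}
    (hgrowth : ∀ z, ‖f z‖ ≤ K * Real.exp (A * ‖z‖))
    (hre : ∀ x : ℝ, ‖f x‖ ≤ L * Real.exp (B * |x|))
    (him : ∀ y : ℝ, ‖f (y * Complex.I)‖ ≤ M) {z : ℂ} (hz : 0 ≤ z.re) :
    ‖f z‖ ≤ M * Real.exp (B * z.re) := by
  have key : ‖Complex.exp (-(B * z)) • f z‖ ≤ M := by
    refine PhragmenLindelof.right_half_plane_of_bounded_on_real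
      (f := fun z => Complex.exp (-(B * z)) • f z) ?_ ?_ ?_ ?_ hz
    · exact Differentiable.diffContOnCl (by fun_prop)
    · refine ⟨1, by norm_num, |B| + A, IsBigO.of_bound K (Eventually.of_forall fun w => ?_)⟩
      rw [norm_smul, Complex.norm_exp, Real.norm_of_nonneg (Real.exp_pos _).le, Real.rpow_one,
        add_mul, Real.exp_add]
      have h1 : (-((B : ℂ) * w)).re ≤ |B| * ‖w‖ := by
        refine (Complex.re_le_norm _).trans ?_
        simp
      calc _ ≤ Real.exp (|B| * ‖w‖) * (K * Real.exp (A * ‖w‖)) := by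
            gcongr
            exact hgrowth w
        _ = _ := by ring
    · refine ⟨L, ?_⟩
      rw [eventually_map]
      filter_upwards [eventually_ge_atTop 0] with x hx
      have h := hre x
      rw [abs_of_nonneg hx] at h
      rw [norm_smul, Complex.norm_exp]
      calc _ ≤ Real.exp (-(B * x)) * (L * Real.exp (B * x)) := by
            gcongr
            simp
        _ = L := by rw [mul_left_comm, ← Real.exp_add]; simp
    · intro y
      rw [norm_smul, Complex.norm_exp]
      simpa using him y
  rw [norm_smul, Complex.norm_exp] at key
  have h2 : (-((B : ℂ) * z)).re = -(B * z.re) := by simp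
  rw [h2] at key
  calc ‖f z‖ = (Real.exp (-(B * z.re)) * ‖f z‖) * Real.exp (B * z.re) := by
        rw [mul_right_comm, ← Real.exp_add]; simp
    _ ≤ _ := by gcongr

/-- An entire function of exponential type that is bounded by `M` on the imaginary axis, and whose
growth along the real axis is of type `B`, is of type `B` in all directions, with constant `M`:
the constants `K` and `L` of the a priori bounds disappear. This is the Phragmén–Lindelöf principle
in the right and in the left half-plane. -/
theorem norm_le_mul_exp_of_bounded_on_imaginary_axis {f : ℂ → E} (hf : Differentiable ℂ f)
    {A B K L M : ℝ} (hB : 0 ≤ B)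
    (hgrowth : ∀ z, ‖f z‖ ≤ K * Real.exp (A * ‖z‖))
    (hre : ∀ x : ℝ, ‖f x‖ ≤ L * Real.exp (B * |x|))
    (him : ∀ y : ℝ, ‖f (y * Complex.I)‖ ≤ M) (z : ℂ) :
    ‖f z‖ ≤ M * Real.exp (B * ‖z‖) := by
  have hM : 0 ≤ M := (norm_nonneg _).trans (him 0)
  rcases le_total 0 z.re with hz | hz
  · refine (norm_le_mul_exp_re_of_nonneg hf hgrowth hre him hz).trans ?_
    gcongr
    exact Complex.re_le_norm z
  · have h := norm_le_mul_exp_re_of_nonneg (f := fun w => f (-w)) (A := A) (B := B) (K := K)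
      (L := L) (M := M) (z := -z) (hf.comp differentiable_neg)
      (fun w => by simpa using hgrowth (-w)) (fun x => by simpa using hre (-x))
      (fun y => by simpa using him (-y)) (by simpa using hz)
    rw [neg_neg] at h
    refine h.trans ?_
    gcongr
    simpa using Complex.re_le_norm (-z)

/-- The Taylor polynomial of degree `d` of an entire function of exponential type `B` is
exponentially precise on the unit disc as soon as `d ≥ e² B`. -/
theorem norm_sub_taylor_le [CompleteSpace E] {f : ℂ → E} (hf : Differentiable ℂ f) {B M : ℝ}
    (hbound : ∀ z, ‖f z‖ ≤ M * Real.exp (B * ‖z‖)) {d : ℕ} (hd : Real.exp 2 * B ≤ d)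
    {z : ℂ} (hz : ‖z‖ ≤ 1) :
    ‖f z - ∑ m ∈ Finset.range (d + 1), ((m.factorial : ℂ)⁻¹ * z ^ m) • iteratedDeriv m f 0‖
      ≤ M * Real.exp (-d) := by
  have hM : 0 ≤ M := by simpa using (norm_nonneg _).trans (hbound 0)
  have hsum := Complex.hasSum_taylorSeries_of_entire hf 0 z
  -- Cauchy's estimate on the circle of radius `e²`
  have hcoeff (m : ℕ) : ‖((m.factorial : ℂ)⁻¹ • (z - 0) ^ m • iteratedDeriv m f 0)‖
      ≤ M * Real.exp d * Real.exp (-2) ^ m := by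
    have h := Complex.norm_iteratedDeriv_le_of_forall_mem_sphere_norm_le (c := 0)
      (R := Real.exp 2) (C := M * Real.exp d) m (Real.exp_pos 2) hf.diffContOnCl
      (fun w hw => by
        refine (hbound w).trans ?_
        rw [mem_sphere_zero_iff_norm.1 hw, mul_comm B]
        gcongr)
    rw [norm_smul, norm_smul, sub_zero, norm_pow, norm_inv, Complex.norm_natCast]
    have hfac : (0 : ℝ) < m.factorial := by positivity
    calc (m.factorial : ℝ)⁻¹ * (‖z‖ ^ m * ‖iteratedDeriv m f 0‖)
        ≤ (m.factorial : ℝ)⁻¹ * (1 * (m.factorial * (M * Real.exp d) / Real.exp 2 ^ m)) := by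
          gcongr
          exact pow_le_one₀ (norm_nonneg _) hz
      _ = M * Real.exp d * Real.exp (-2) ^ m := by
          rw [Real.exp_neg, inv_pow]
          field_simp
  have htail := (hasSum_nat_add_iff' (d + 1)).2 hsum
  have hq : Real.exp (-2) ≤ 1 / 2 := by
    rw [Real.exp_neg, ← one_div]
    have := Real.add_one_le_exp (2 : ℝ)
    exact one_div_le_one_div_of_le (by norm_num) (by linarith)
  have hgeo := (hasSum_geometric_of_lt_one (Real.exp_pos (-2)).le (by linarith)).mul_left
    (M * Real.exp d * Real.exp (-2) ^ (d + 1))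
  have hle := htail.norm_le_of_bounded hgeo (fun m => by
    refine (hcoeff _).trans (le_of_eq ?_)
    rw [pow_add _ m (d + 1)]; ring)
  simp only [sub_zero, smul_smul] at hle
  refine hle.trans ?_
  have h3 : Real.exp (-2) ^ (d + 1) = Real.exp (-2 * d) * Real.exp (-2) := by
    rw [pow_succ, ← Real.exp_nat_mul]; ring_nf
  have h4 : Real.exp (-2) * (1 - Real.exp (-2))⁻¹ ≤ 1 := by
    rw [← div_eq_mul_inv, div_le_one (by linarith)]
    linarith
  calc M * Real.exp d * Real.exp (-2) ^ (d + 1) * (1 - Real.exp (-2))⁻¹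
      = M * (Real.exp d * Real.exp (-2 * d)) * (Real.exp (-2) * (1 - Real.exp (-2))⁻¹) := by
        rw [h3]; ring
    _ ≤ M * (Real.exp d * Real.exp (-2 * d)) * 1 := by gcongr
    _ = M * Real.exp (-d) := by rw [mul_one, ← Real.exp_add]; ring_nf

end EntireFunctions

/-! ### Conjugation by a one-parameter group -/

section ConjFlow

variable {𝔸 : Type*} [NormedRing 𝔸] [NormedAlgebra ℂ 𝔸]

/-- The entire function `z ↦ e^{zH} T e^{-zH}`; at `z = -i` it is the Heisenberg-type evolution
`e^{-iH} T e^{iH}`. -/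
noncomputable def conjFlow (H T : 𝔸) (z : ℂ) : 𝔸 :=
  NormedSpace.exp (z • H) * T * NormedSpace.exp (z • -H)

theorem conjFlow_zero (H T : 𝔸) : conjFlow H T 0 = T := by
  simp [conjFlow]

theorem conjFlow_sum {ι : Type*} (s : Finset ι) (H : 𝔸) (T : ι → 𝔸) (z : ℂ) :
    conjFlow H (∑ i ∈ s, T i) z = ∑ i ∈ s, conjFlow H (T i) z := by
  simp [conjFlow, Finset.mul_sum, Finset.sum_mul]

theorem norm_exp_le_exp_norm [NormOneClass 𝔸] (x : 𝔸) :
    ‖NormedSpace.exp x‖ ≤ Real.exp ‖x‖ := by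
  rw [NormedSpace.exp_eq_tsum ℂ, Real.exp_eq_exp_ℝ, NormedSpace.exp_eq_tsum ℝ]
  refine tsum_of_norm_bounded (NormedSpace.expSeries_summable' (𝕂 := ℝ) ‖x‖).hasSum fun m => ?_
  rw [norm_smul, norm_inv, Complex.norm_natCast, smul_eq_mul]
  gcongr
  exact norm_pow_le x m

theorem norm_conjFlow_le [NormOneClass 𝔸] (H T : 𝔸) (z : ℂ) :
    ‖conjFlow H T z‖ ≤ ‖T‖ * Real.exp (2 * ‖H‖ * ‖z‖) := by
  have h1 : ‖NormedSpace.exp (z • H)‖ ≤ Real.exp (‖z‖ * ‖H‖) := by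
    simpa [norm_smul] using norm_exp_le_exp_norm (z • H)
  have h2 : ‖NormedSpace.exp (z • -H)‖ ≤ Real.exp (‖z‖ * ‖H‖) := by
    simpa [norm_smul] using norm_exp_le_exp_norm (z • -H)
  calc _ ≤ ‖NormedSpace.exp (z • H)‖ * ‖T‖ * ‖NormedSpace.exp (z • -H)‖ :=
        (norm_mul_le _ _).trans (by gcongr; exact norm_mul_le _ _)
    _ ≤ Real.exp (‖z‖ * ‖H‖) * ‖T‖ * Real.exp (‖z‖ * ‖H‖) := by gcongr
    _ = _ := by
      rw [mul_right_comm, ← Real.exp_add, mul_comm]; ring_nf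

variable [CompleteSpace 𝔸]

theorem hasDerivAt_conjFlow (H T : 𝔸) (z : ℂ) :
    HasDerivAt (conjFlow H T) (conjFlow H ⁅H, T⁆ z) z := by
  have h := ((hasDerivAt_exp_smul_const H z).mul_const T).mul (hasDerivAt_exp_smul_const' (-H) z)
  refine h.congr_deriv ?_
  simp only [conjFlow, Ring.lie_def]
  noncomm_ring

theorem differentiable_conjFlow (H T : 𝔸) : Differentiable ℂ (conjFlow H T) :=
  fun z => (hasDerivAt_conjFlow H T z).differentiableAt

theorem iteratedDeriv_conjFlow (H T : 𝔸) (m : ℕ) :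
    iteratedDeriv m (conjFlow H T) = conjFlow H ((fun X => ⁅H, X⁆)^[m] T) := by
  induction m with
  | zero => simp
  | succ m ih =>
    rw [iteratedDeriv_succ, ih, Function.iterate_succ_apply']
    exact funext fun z => (hasDerivAt_conjFlow H _ z).deriv

/-- Summands of the generator which commute with `T` and with the rest of the generator do not
contribute to the flow of `T`. -/
theorem conjFlow_add_of_commute {G G' T : 𝔸} (hG : Commute G G') (hT : Commute G' T) (z : ℂ) :
    conjFlow (G + G') T z = conjFlow G T z := by
  let _ : NormedAlgebra ℚ 𝔸 := .restrictScalars ℚ ℂ 𝔸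
  have hneg : z • -(G + G') = z • -G' + z • -G := by rw [neg_add_rev, smul_add]
  have h1 : NormedSpace.exp (z • (G + G')) = NormedSpace.exp (z • G) * NormedSpace.exp (z • G') := by
    rw [smul_add, NormedSpace.exp_add_of_commute ((hG.smul_left z).smul_right z)]
  have h2 : NormedSpace.exp (z • -(G + G'))
      = NormedSpace.exp (z • -G') * NormedSpace.exp (z • -G) := by
    rw [hneg, NormedSpace.exp_add_of_commute]
    exact ((hG.symm.neg_left.neg_right).smul_left z).smul_right z
  have h3 : NormedSpace.exp (z • G') * T = T * NormedSpace.exp (z • G') :=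
    (hT.smul_left z).exp_left
  have h4 : NormedSpace.exp (z • G') * NormedSpace.exp (z • -G') = 1 := by
    rw [smul_neg, ← NormedSpace.exp_add_of_commute (Commute.refl _).neg_right]
    simp
  calc conjFlow (G + G') T z
      = NormedSpace.exp (z • G) * (NormedSpace.exp (z • G') * T) * NormedSpace.exp (z • -G')
          * NormedSpace.exp (z • -G) := by
        simp only [conjFlow, h1, h2, mul_assoc]
    _ = NormedSpace.exp (z • G) * T * (NormedSpace.exp (z • G') * NormedSpace.exp (z • -G'))
          * NormedSpace.exp (z • -G) := by
        rw [h3]; simp only [mul_assoc]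
    _ = conjFlow G T z := by rw [h4, mul_one, conjFlow]

variable [StarRing 𝔸] [CStarRing 𝔸] [StarModule ℂ 𝔸]

theorem exp_smul_mul_I_mem_unitary {H : 𝔸} (hH : IsSelfAdjoint H) (y : ℝ) :
    NormedSpace.exp ((y * Complex.I) • H) ∈ unitary 𝔸 := by
  let _ : NormedAlgebra ℚ 𝔸 := .restrictScalars ℚ ℂ 𝔸
  exact NormedSpace.exp_mem_unitary_of_mem_skewAdjoint
    (hH.smul_mem_skewAdjoint (by simp [skewAdjoint.mem_iff]))

theorem norm_conjFlow_mul_I {H : 𝔸} (hH : IsSelfAdjoint H) (T : 𝔸) (y : ℝ) :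
    ‖conjFlow H T (y * Complex.I)‖ = ‖T‖ := by
  rw [conjFlow, CStarRing.norm_mul_mem_unitary _ (exp_smul_mul_I_mem_unitary hH.neg y),
    CStarRing.norm_mem_unitary_mul _ (exp_smul_mul_I_mem_unitary hH y)]

end ConjFlow

/-! ### Supports of operators -/

section Support

variable {n : ℕ}

/-- Entrywise form of triviality on a qubit: the matrix vanishes unless both labels agree at `q`,
and its entries do not change when both labels are changed at `q` to a common value. -/
theorem actsTriviallyOn_iff {A : Op n} {q : Fin n} :
    ActsTriviallyOn A q ↔ (∀ x y, x q ≠ y q → A x y = 0) ∧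
      ∀ x y c, x q = y q → A (Function.update x q c) (Function.update y q c) = A x y := by
  constructor
  · rintro ⟨B, hB⟩
    refine ⟨fun x y h => by rw [hB, if_neg h], fun x y c h => ?_⟩
    rw [hB, hB, if_pos h, if_pos (by simp)]
    congr 1 <;> funext j <;> simp [Function.update_of_ne j.2]
  · rintro ⟨h0, h1⟩
    refine ⟨fun u v => A (fun j => if h : j ≠ q then u ⟨j, h⟩ else 0)
      (fun j => if h : j ≠ q then v ⟨j, h⟩ else 0), fun x y => ?_⟩
    split_ifs with h
    · rw [← h1 x y 0 h]
      congr 1 <;> funext j <;> by_cases hj : j = q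
      · subst hj; simp
      · simp [hj]
      · subst hj; simp
      · simp [hj]
    · exact h0 x y h

theorem ActsTriviallyOn.one (q : Fin n) : ActsTriviallyOn (1 : Op n) q := by
  refine actsTriviallyOn_iff.2 ⟨fun x y h => Matrix.one_apply_ne fun hxy => h (by rw [hxy]),
    fun x y c h => ?_⟩
  by_cases hxy : x = y
  · rw [hxy, Matrix.one_apply_eq, Matrix.one_apply_eq]
  · rw [Matrix.one_apply_ne hxy, Matrix.one_apply_ne]
    intro he
    refine hxy (funext fun j => ?_)
    by_cases hj : j = q
    · rw [hj, h]
    · simpa [hj] using congrFun he j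

theorem ActsTriviallyOn.add {A B : Op n} {q : Fin n} (hA : ActsTriviallyOn A q)
    (hB : ActsTriviallyOn B q) : ActsTriviallyOn (A + B) q := by
  rw [actsTriviallyOn_iff] at *
  refine ⟨fun x y h => ?_, fun x y c h => ?_⟩
  · rw [Matrix.add_apply, hA.1 x y h, hB.1 x y h, add_zero]
  · rw [Matrix.add_apply, Matrix.add_apply, hA.2 x y c h, hB.2 x y c h]

theorem ActsTriviallyOn.smul {A : Op n} {q : Fin n} (hA : ActsTriviallyOn A q) (a : ℂ) :
    ActsTriviallyOn (a • A) q := by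
  rw [actsTriviallyOn_iff] at *
  refine ⟨fun x y h => ?_, fun x y c h => ?_⟩
  · rw [Matrix.smul_apply, hA.1 x y h, smul_zero]
  · rw [Matrix.smul_apply, Matrix.smul_apply, hA.2 x y c h]

theorem ActsTriviallyOn.sub {A B : Op n} {q : Fin n} (hA : ActsTriviallyOn A q)
    (hB : ActsTriviallyOn B q) : ActsTriviallyOn (A - B) q := by
  have h := hA.add (hB.smul (-1))
  rwa [neg_smul, one_smul, ← sub_eq_add_neg] at h

theorem ActsTriviallyOn.mul {A B : Op n} {q : Fin n} (hA : ActsTriviallyOn A q)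
    (hB : ActsTriviallyOn B q) : ActsTriviallyOn (A * B) q := by
  rw [actsTriviallyOn_iff] at *
  refine ⟨fun x y h => ?_, fun x y c h => ?_⟩
  · rw [Matrix.mul_apply]
    refine Finset.sum_eq_zero fun z _ => ?_
    by_cases hz : x q = z q
    · rw [hB.1 z y (hz ▸ h), mul_zero]
    · rw [hA.1 x z hz, zero_mul]
  · rw [Matrix.mul_apply, Matrix.mul_apply]
    -- exchanging the values `c` and `x q` at `q` is a permutation of the summation labels
    let e : Basis n ≃ Basis n := Equiv.piCongrRight fun j =>
      if j = q then Equiv.swap (x q) c else Equiv.refl _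
    have he (z : Basis n) (hz : z q = x q) : e z = Function.update z q c := by
      funext j
      by_cases hj : j = q
      · subst hj; simp [e, hz]
      · simp [e, hj]
    refine (Fintype.sum_equiv e _ _ fun z => ?_).symm
    by_cases hz : z q = x q
    · rw [he z hz, hA.2 x z c hz.symm, hB.2 z y c (hz.trans h)]
    · have h1 : e z q ≠ c := by
        simp only [e, Equiv.piCongrRight_apply, Pi.map_apply, if_true]
        exact fun h' => hz ((Equiv.swap (x q) c).injective (by rw [h', Equiv.swap_apply_left]))
      rw [hA.1 x z (Ne.symm hz), hA.1 _ (e z) (by simpa using h1.symm), zero_mul, zero_mul]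

theorem notMem_qubitSupport {A : Op n} {q : Fin n} :
    q ∉ qubitSupport A ↔ ActsTriviallyOn A q := by
  simp [qubitSupport]

theorem qubitSupport_subset_iff {A : Op n} {S : Finset (Fin n)} :
    qubitSupport A ⊆ S ↔ ∀ q ∉ S, ActsTriviallyOn A q := by
  refine ⟨fun h q hq => notMem_qubitSupport.1 fun h' => hq (h h'), fun h q hq => ?_⟩
  by_contra hS
  exact notMem_qubitSupport.2 (h q hS) hq

theorem apply_eq_zero_of_qubitSupport_subset {A : Op n} {S : Finset (Fin n)}
    (hA : qubitSupport A ⊆ S) {x y : Basis n} {q : Fin n} (hq : q ∉ S) (h : x q ≠ y q) :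
    A x y = 0 :=
  (actsTriviallyOn_iff.1 (qubitSupport_subset_iff.1 hA q hq)).1 x y h

/-- Where an operator acts trivially, the two labels may be replaced by any other common values. -/
theorem apply_piecewise_of_disjoint {A : Op n} {D : Finset (Fin n)}
    (hA : Disjoint (qubitSupport A) D) {x y : Basis n} (hxy : ∀ q ∈ D, x q = y q) (u : Basis n) :
    A (D.piecewise u x) (D.piecewise u y) = A x y := by
  induction D using Finset.induction_on with
  | empty => simp
  | insert q D hq ih =>
    rw [Finset.disjoint_insert_right] at hA
    rw [Finset.piecewise_insert, Finset.piecewise_insert,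
      (actsTriviallyOn_iff.1 (notMem_qubitSupport.1 hA.1)).2,
      ih hA.2 fun r hr => hxy r (Finset.mem_insert_of_mem hr)]
    simp [hq, hxy q (Finset.mem_insert_self q D)]

theorem commute_of_disjoint_qubitSupport {A B : Op n}
    (h : Disjoint (qubitSupport A) (qubitSupport B)) : Commute A B := by
  set S := qubitSupport A with hS
  have hBS : qubitSupport B ⊆ Sᶜ := Finset.subset_compl_iff_disjoint_left.2 h
  ext x y
  rw [Matrix.mul_apply, Matrix.mul_apply]
  -- in each of the two products only one intermediate label contributes
  rw [Finset.sum_eq_single (S.piecewise y x), Finset.sum_eq_single (S.piecewise x y)]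
  · have h1 : A x (S.piecewise y x) = A (S.piecewise x y) y := by
      have := apply_piecewise_of_disjoint (A := A) (D := Sᶜ) (x := x) (y := S.piecewise y x)
        (hS ▸ disjoint_compl_right) (fun q hq => by simp [Finset.mem_compl.1 hq]) y
      rw [← this]
      congr 1 <;> funext q <;> by_cases hq : q ∈ S <;> simp [hq]
    have h2 : B (S.piecewise y x) y = B x (S.piecewise x y) := by
      have := apply_piecewise_of_disjoint (A := B) (D := S) (x := x) (y := S.piecewise x y)
        h.symm (fun q hq => by simp [hq]) y
      rw [← this]
      congr 1
      funext q; by_cases hq : q ∈ S <;> simp [hq]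
    rw [h1, h2, mul_comm]
  · intro z _ hz
    obtain ⟨q, hq⟩ := Function.ne_iff.1 hz
    by_cases hqS : q ∈ S
    · rw [apply_eq_zero_of_qubitSupport_subset hBS (q := q) (by simpa using hqS)
        (by simpa [hqS] using hq.symm), zero_mul]
    · rw [apply_eq_zero_of_qubitSupport_subset (A := A) le_rfl hqS (by simpa [hqS] using hq),
        mul_zero]
  · simp
  · intro z _ hz
    obtain ⟨q, hq⟩ := Function.ne_iff.1 hz
    by_cases hqS : q ∈ S
    · rw [apply_eq_zero_of_qubitSupport_subset hBS (q := q) (by simpa using hqS)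
        (by simpa [hqS] using hq), mul_zero]
    · rw [apply_eq_zero_of_qubitSupport_subset (A := A) le_rfl hqS
        (by simpa [hqS] using hq.symm), zero_mul]
  · simp

theorem qubitSupport_mul_subset (A B : Op n) :
    qubitSupport (A * B) ⊆ qubitSupport A ∪ qubitSupport B :=
  qubitSupport_subset_iff.2 fun q hq => by
    rw [Finset.notMem_union, notMem_qubitSupport, notMem_qubitSupport] at hq
    exact hq.1.mul hq.2

theorem qubitSupport_lie_subset (A B : Op n) :
    qubitSupport ⁅A, B⁆ ⊆ qubitSupport A ∪ qubitSupport B :=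
  qubitSupport_subset_iff.2 fun q hq => by
    rw [Finset.notMem_union, notMem_qubitSupport, notMem_qubitSupport] at hq
    exact (hq.1.mul hq.2).sub (hq.2.mul hq.1)

end Support

/-! ### Local operators -/

section Local

variable {n : ℕ}

/-- The `k`-local operators are the linear span of the operators supported on `k` qubits. -/
theorem isLocal_iff_mem_span {k : ℕ} {R : Op n} :
    IsLocal k R ↔ R ∈ Submodule.span ℂ {T : Op n | (qubitSupport T).card ≤ k} := by
  constructor
  · rintro ⟨m, T, hT, rfl⟩
    exact Submodule.sum_mem _ fun i _ => Submodule.subset_span (hT i)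
  · intro h
    induction h using Submodule.span_induction with
    | mem T hT => exact ⟨1, fun _ => T, fun _ => hT, by simp⟩
    | zero => exact ⟨0, fun i => i.elim0, fun i => i.elim0, by simp⟩
    | add A B _ _ hA hB =>
      obtain ⟨a, S, hS, rfl⟩ := hA
      obtain ⟨b, T, hT, rfl⟩ := hB
      refine ⟨a + b, Fin.append S T, fun i => ?_, by simp [Fin.sum_univ_add]⟩
      refine Fin.addCases (fun i => ?_) (fun i => ?_) i
      · simpa using hS i
      · simpa using hT i
    | smul c A _ hA =>
      obtain ⟨a, S, hS, rfl⟩ := hA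
      refine ⟨a, fun i => c • S i, fun i => ?_, by rw [Finset.smul_sum]⟩
      refine (Finset.card_le_card (qubitSupport_subset_iff.2 fun q hq => ?_)).trans (hS i)
      exact (notMem_qubitSupport.1 hq).smul c

theorem IsLocal.of_card_le {k : ℕ} {T : Op n} (h : (qubitSupport T).card ≤ k) : IsLocal k T :=
  isLocal_iff_mem_span.2 (Submodule.subset_span h)

theorem IsLocal.mono {k k' : ℕ} (hk : k ≤ k') {R : Op n} (h : IsLocal k R) : IsLocal k' R :=
  let ⟨m, T, hT, hR⟩ := h
  ⟨m, T, fun i => (hT i).trans hk, hR⟩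

theorem IsLocal.smul {k : ℕ} (c : ℂ) {R : Op n} (h : IsLocal k R) : IsLocal k (c • R) :=
  isLocal_iff_mem_span.2 (Submodule.smul_mem _ c (isLocal_iff_mem_span.1 h))

theorem IsLocal.sum {k : ℕ} {ι : Type*} {s : Finset ι} {R : ι → Op n}
    (h : ∀ i ∈ s, IsLocal k (R i)) : IsLocal k (∑ i ∈ s, R i) :=
  isLocal_iff_mem_span.2 (Submodule.sum_mem _ fun i hi => isLocal_iff_mem_span.1 (h i hi))

theorem IsLocal.one : IsLocal 0 (1 : Op n) := by
  refine .of_card_le (le_of_eq (Finset.card_eq_zero.2 (Finset.subset_empty.1 ?_)))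
  exact qubitSupport_subset_iff.2 fun q _ => .one q

theorem IsLocal.mul {a b : ℕ} {A B : Op n} (hA : IsLocal a A) (hB : IsLocal b B) :
    IsLocal (a + b) (A * B) := by
  obtain ⟨m, S, hS, rfl⟩ := hA
  obtain ⟨m', T, hT, rfl⟩ := hB
  rw [Finset.sum_mul_sum]
  refine .sum fun i _ => .sum fun j _ => .of_card_le ?_
  exact (Finset.card_le_card (qubitSupport_mul_subset _ _)).trans
    ((Finset.card_union_le _ _).trans (add_le_add (hS i) (hT j)))

theorem IsLocal.pow {a : ℕ} {A : Op n} (hA : IsLocal a A) (m : ℕ) : IsLocal (m * a) (A ^ m) := by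
  induction m with
  | zero => simpa using IsLocal.one
  | succ m ih =>
    rw [pow_succ, Nat.succ_mul]
    exact ih.mul hA

/-- Commuting with a Hamiltonian of range `ℓ` enlarges supports by at most `ℓ` qubits, as terms
away from the support of the operator do not contribute. -/
theorem CommutingLocalHamiltonian.isLocal_lie {ℓ k : ℕ} (H : CommutingLocalHamiltonian n ℓ)
    {R : Op n} (hR : IsLocal k R) : IsLocal (k + ℓ) ⁅H.op, R⁆ := by
  obtain ⟨m, T, hT, rfl⟩ := hR
  rw [op, Ring.lie_def, Finset.sum_mul_sum, Finset.sum_mul_sum, Finset.sum_comm,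
    ← Finset.sum_sub_distrib]
  refine .sum fun i _ => ?_
  rw [← Finset.sum_sub_distrib]
  refine .sum fun j _ => .of_card_le ?_
  have h := (Finset.card_le_card (qubitSupport_lie_subset (H.term j) (T i))).trans
    (Finset.card_union_le _ _)
  have := H.card_qubitSupport_le j
  have := hT i
  rw [Ring.lie_def] at h
  lia

theorem CommutingLocalHamiltonian.isLocal_iterate_lie {ℓ k : ℕ}
    (H : CommutingLocalHamiltonian n ℓ) {R : Op n} (hR : IsLocal k R) (m : ℕ) :
    IsLocal (k + m * ℓ) ((fun X => ⁅H.op, X⁆)^[m] R) := by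
  induction m with
  | zero => simpa using hR
  | succ m ih =>
    rw [Function.iterate_succ_apply', Nat.succ_mul, ← add_assoc]
    exact H.isLocal_lie ih

end Local

/-! ### One step of the evolution -/

namespace CommutingLocalHamiltonian

variable {n ℓ : ℕ} (H : CommutingLocalHamiltonian n ℓ)

theorem isSelfAdjoint_op : IsSelfAdjoint H.op := H.isHermitian

theorem conjFlow_op_eq_subsetOp (T : Op n) (z : ℂ) :
    conjFlow H.op T z = conjFlow (H.subsetOp (qubitSupport T)) T z := by
  have hsplit : H.op = H.subsetOp (qubitSupport T) +
      ∑ i with ¬ (qubitSupport (H.term i) ∩ qubitSupport T).Nonempty, H.term i :=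
    (Finset.sum_filter_add_sum_filter_not _ _ _).symm
  rw [hsplit]
  refine conjFlow_add_of_commute ?_ ?_ z
  · exact Commute.sum_left _ _ _ fun i _ => Commute.sum_right _ _ _ fun j _ => H.commute i j
  · refine Commute.sum_left _ _ _ fun i hi => commute_of_disjoint_qubitSupport ?_
    rw [Finset.disjoint_iff_inter_eq_empty]
    simpa [Finset.not_nonempty_iff_eq_empty] using hi

/-- The flow of a `k`-local operator has the exponential type that the norm constraint gives to
operators on `k` qubits. Along the real axis this holds term by term, with a constant depending on
the decomposition; the bound by `‖R‖` on the imaginary axis, where the flow is unitary, then makes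
the constant independent of it. -/
theorem norm_conjFlow_le_of_isLocal {α C : ℝ} (hα : α ≤ 1) (hC : 0 ≤ C)
    (hH : H.NormConstraint α C) {k : ℕ} {R : Op n} (hR : IsLocal k R) (z : ℂ) :
    ‖conjFlow H.op R z‖ ≤
      ‖R‖ * Real.exp (2 * (C * (n : ℝ) ^ α * (k : ℝ) ^ (1 - α)) * ‖z‖) := by
  obtain ⟨m, T, hT, hsum⟩ := hR
  refine norm_le_mul_exp_of_bounded_on_imaginary_axis (L := ∑ i, ‖T i‖)
    (differentiable_conjFlow H.op R) (by positivity) (norm_conjFlow_le H.op R) (fun x => ?_)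
    (fun y => (norm_conjFlow_mul_I H.isSelfAdjoint_op R y).le) z
  rw [hsum, conjFlow_sum, Finset.sum_mul]
  refine norm_sum_le_of_le _ fun i _ => ?_
  rw [conjFlow_op_eq_subsetOp]
  refine (norm_conjFlow_le _ _ _).trans ?_
  rw [Complex.norm_real, Real.norm_eq_abs]
  have h : ‖H.subsetOp (qubitSupport (T i))‖ ≤ C * (n : ℝ) ^ α * (k : ℝ) ^ (1 - α) := by
    refine (hH (qubitSupport (T i))).trans ?_
    have : (0 : ℝ) ≤ 1 - α := by linarith
    gcongr
    exact hT i
  gcongr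

theorem conjTranspose_unitary :
    H.unitaryᴴ = NormedSpace.exp ((-Complex.I) • -H.op) := by
  rw [unitary, ← Matrix.exp_conjTranspose, Matrix.conjTranspose_smul, H.isSelfAdjoint_op.isHermitian]
  simp

theorem unitary_mul_mul_conjTranspose (R : Op n) :
    H.unitary * R * H.unitaryᴴ = conjFlow H.op R (-Complex.I) := by
  rw [conjTranspose_unitary, unitary, conjFlow]

theorem norm_unitary_mul_mul_conjTranspose (R : Op n) :
    ‖H.unitary * R * H.unitaryᴴ‖ = ‖R‖ := by
  rw [unitary_mul_mul_conjTranspose]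
  simpa using norm_conjFlow_mul_I H.isSelfAdjoint_op R (-1)

/-- Truncating the Taylor series of the flow approximates the evolved operator. The error is
relative to the norm of `R` only, whatever the number of its local terms. -/
theorem isApproxLocal_unitary_conj_of_isLocal {α C : ℝ} (hα : α ≤ 1) (hC : 0 ≤ C)
    (hH : H.NormConstraint α C) {k d : ℕ} {R : Op n} (hR : IsLocal k R)
    (hd : Real.exp 2 * (2 * (C * (n : ℝ) ^ α * (k : ℝ) ^ (1 - α))) ≤ d) :
    IsApproxLocal (k + d * ℓ) (‖R‖ * Real.exp (-d)) (H.unitary * R * H.unitaryᴴ) := by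
  refine ⟨∑ m ∈ Finset.range (d + 1), ((m.factorial : ℂ)⁻¹ * (-Complex.I) ^ m) •
    iteratedDeriv m (conjFlow H.op R) 0, .sum fun m hm => ?_, ?_⟩
  · rw [iteratedDeriv_conjFlow, conjFlow_zero]
    refine (IsLocal.mono ?_ (H.isLocal_iterate_lie hR m)).smul _
    gcongr
    exact Nat.lt_succ_iff.1 (Finset.mem_range.1 hm)
  · rw [unitary_mul_mul_conjTranspose]
    exact norm_sub_taylor_le (differentiable_conjFlow H.op R)
      (H.norm_conjFlow_le_of_isLocal hα hC hH hR) hd (by simp)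

theorem isApproxLocal_unitary_conj {α C : ℝ} (hα : α ≤ 1) (hC : 0 ≤ C)
    (hH : H.NormConstraint α C) {k d : ℕ} {ε : ℝ} {Q : Op n} (hQ : IsApproxLocal k ε Q)
    (hnorm : ‖Q‖ ≤ 1) (hd : Real.exp 2 * (2 * (C * (n : ℝ) ^ α * (k : ℝ) ^ (1 - α))) ≤ d) :
    IsApproxLocal (k + d * ℓ) (ε + (1 + ε) * Real.exp (-d)) (H.unitary * Q * H.unitaryᴴ) := by
  obtain ⟨R, hR, hQR⟩ := hQ
  obtain ⟨R', hR', hRR'⟩ := H.isApproxLocal_unitary_conj_of_isLocal hα hC hH hR hd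
  refine ⟨R', hR', ?_⟩
  have h1 : ‖R‖ ≤ 1 + ε := by
    have := norm_sub_norm_le R Q
    rw [norm_sub_rev] at this
    linarith
  have h2 : H.unitary * Q * H.unitaryᴴ - R' =
      H.unitary * (Q - R) * H.unitaryᴴ + (H.unitary * R * H.unitaryᴴ - R') := by noncomm_ring
  rw [h2]
  refine (norm_add_le _ _).trans (add_le_add ?_ (hRR'.trans (by gcongr)))
  rwa [norm_unitary_mul_mul_conjTranspose]

end CommutingLocalHamiltonian

theorem outputState_succ {n ℓ p : ℕ} (H : Fin (p + 1) → CommutingLocalHamiltonian n ℓ)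
    (ρ₀ : Op n) :
    outputState H ρ₀ = (H (Fin.last p)).unitary * outputState (fun i => H i.castSucc) ρ₀ *
      (H (Fin.last p)).unitaryᴴ := by
  simp only [outputState, evolution, Matrix.conjTranspose_mul, mul_assoc]

theorem norm_outputState {n ℓ : ℕ} (ρ₀ : Op n) : ∀ {p : ℕ}
    (H : Fin p → CommutingLocalHamiltonian n ℓ), ‖outputState H ρ₀‖ = ‖ρ₀‖
  | 0, H => by simp [outputState, evolution]
  | p + 1, H => by
    rw [outputState_succ, CommutingLocalHamiltonian.norm_unitary_mul_mul_conjTranspose,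
      norm_outputState]

/-- Iterating the step bound: if `k₀ ≤ n ^ (3/4)`, then after `p` steps the range is at most
`c ^ p * n ^ (1 - (1 - α) ^ p / 4)` with `c` depending on `ℓ` and `C` only, and every step adds
at most `2 exp (-n ^ (3/4))` to the error. -/
theorem exists_isApproxLocal_outputState {n ℓ : ℕ} (hn : 1 ≤ n) {α C : ℝ} (hα0 : 0 ≤ α)
    (hα1 : α ≤ 1) (hC : 0 ≤ C) {k₀ : ℕ} {ε : ℝ} {ρ₀ : Op n}
    (hk₀ : (k₀ : ℝ) ≤ (n : ℝ) ^ (3 / 4 : ℝ)) (hρ : IsApproxLocal k₀ ε ρ₀) (hnorm : ‖ρ₀‖ ≤ 1) :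
    ∀ {p : ℕ} (H : Fin p → CommutingLocalHamiltonian n ℓ), (∀ i, (H i).NormConstraint α C) →
      ε + 2 * p * Real.exp (-(n : ℝ) ^ (3 / 4 : ℝ)) ≤ 1 →
      ∃ k : ℕ, (k : ℝ) ≤ (1 + (2 * Real.exp 2 * C + 2) * ℓ) ^ p *
          (n : ℝ) ^ (1 - (1 - α) ^ p / 4) ∧
        IsApproxLocal k (ε + 2 * p * Real.exp (-(n : ℝ) ^ (3 / 4 : ℝ))) (outputState H ρ₀)
  | 0, H, _, _ => ⟨k₀, by norm_num; exact hk₀, by simpa [outputState, evolution] using hρ⟩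
  | p + 1, H, hH, hε => by
    set D : ℝ := 2 * Real.exp 2 * C with hD
    have hD0 : 0 ≤ D := by positivity
    set c : ℝ := 1 + (D + 2) * ℓ with hc
    have hc1 : 1 ≤ c := by rw [hc, le_add_iff_nonneg_right]; positivity
    have hnR : (1 : ℝ) ≤ n := by exact_mod_cast hn
    have hn0 : (0 : ℝ) < n := by linarith
    set δ := Real.exp (-(n : ℝ) ^ (3 / 4 : ℝ)) with hδ
    have hδ0 : 0 < δ := Real.exp_pos _
    have hε' : ε + 2 * p * δ ≤ 1 := by
      push_cast at hε
      linarith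
    obtain ⟨k, hk, hloc⟩ := exists_isApproxLocal_outputState hn hα0 hα1 hC hk₀ hρ hnorm
      (fun i => H i.castSucc) (fun i => hH _) hε'
    set β : ℝ := (1 - α) ^ p with hβ
    have hβ0 : 0 ≤ β := pow_nonneg (by linarith) p
    have hβ1 : (1 - α) ^ (p + 1) = β * (1 - α) := pow_succ _ _
    have hβle : β * (1 - α) ≤ 1 := by
      rw [← hβ1]; exact pow_le_one₀ (by linarith) (by linarith)
    set N : ℝ := c ^ p * (n : ℝ) ^ (1 - (1 - α) ^ (p + 1) / 4) with hN
    have hcp : 1 ≤ c ^ p := one_le_pow₀ hc1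
    have hN34 : (n : ℝ) ^ (3 / 4 : ℝ) ≤ N := by
      refine le_trans ?_ (le_mul_of_one_le_left (by positivity) hcp)
      refine Real.rpow_le_rpow_of_exponent_le hnR ?_
      rw [hβ1]; linarith
    have hN1 : 1 ≤ N := (Real.one_le_rpow hnR (by norm_num)).trans hN34
    have hkN : (k : ℝ) ≤ N := by
      refine hk.trans ?_
      rw [hN, hβ1]
      have : β * (1 - α) ≤ β := mul_le_of_le_one_right hβ0 (by linarith)
      gcongr
    -- the recursion `k ↦ n ^ α * k ^ (1 - α)` sends the bound of level `p` to that of level `p + 1`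
    have hrec : (n : ℝ) ^ α * (k : ℝ) ^ (1 - α) ≤ N := by
      calc (n : ℝ) ^ α * (k : ℝ) ^ (1 - α)
          ≤ (n : ℝ) ^ α * (c ^ p * (n : ℝ) ^ (1 - β / 4)) ^ (1 - α) := by
            have : (0 : ℝ) ≤ 1 - α := by linarith
            gcongr
        _ = (c ^ p) ^ (1 - α) * ((n : ℝ) ^ α * (n : ℝ) ^ ((1 - β / 4) * (1 - α))) := by
            rw [Real.mul_rpow (by positivity) (by positivity), ← Real.rpow_mul hn0.le]
            ring
        _ ≤ (c ^ p) ^ (1 : ℝ) * (n : ℝ) ^ (1 - (1 - α) ^ (p + 1) / 4) := by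
            rw [← Real.rpow_add hn0, hβ1]
            have h1 : α + (1 - β / 4) * (1 - α) = 1 - β * (1 - α) / 4 := by ring
            rw [h1]
            gcongr
            linarith
        _ = N := by rw [Real.rpow_one]
    set d : ℕ := ⌈(D + 1) * N⌉₊ with hd
    have hdge : (D + 1) * N ≤ d := Nat.le_ceil _
    have hdlt : (d : ℝ) < (D + 1) * N + 1 := Nat.ceil_lt_add_one (by positivity)
    have hstep := (H (Fin.last p)).isApproxLocal_unitary_conj hα1 hC (hH _) (d := d) hloc
      ((norm_outputState ρ₀ _).trans_le hnorm) (by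
        refine le_trans ?_ hdge
        calc _ = D * ((n : ℝ) ^ α * (k : ℝ) ^ (1 - α)) := by rw [hD]; ring
          _ ≤ D * N := by gcongr
          _ ≤ (D + 1) * N := by gcongr; linarith)
    rw [← outputState_succ] at hstep
    refine ⟨k + d * ℓ, ?_, ?_⟩
    · push_cast
      calc (k : ℝ) + d * ℓ ≤ N + ((D + 1) * N + N) * ℓ := by gcongr; linarith
        _ = c ^ (p + 1) * (n : ℝ) ^ (1 - (1 - α) ^ (p + 1) / 4) := by
          rw [pow_succ c, hN]
          rw [hc]
          ring
    · obtain ⟨R, hR, hle⟩ := hstep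
      refine ⟨R, hR, hle.trans ?_⟩
      have h1 : Real.exp (-d) ≤ δ := by
        refine Real.exp_le_exp.2 (neg_le_neg (hN34.trans (le_trans ?_ hdge)))
        nlinarith
      have h2 : (1 + (ε + 2 * p * δ)) * Real.exp (-d) ≤ 2 * δ := by
        gcongr
        linarith
      push_cast
      linarith

/-! ### A Chebyshev approximation of the indicator of zero -/

/-- A polynomial of degree at most `d` with value `1` at `0` which is exponentially small in
`d / √n` at `1, …, n`: a rescaled Chebyshev polynomial `T_d`, with `1, …, n` mapped into `[-1, 1]`
and `0` mapped to `cosh (1 / √n)`. -/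
theorem exists_polynomial_eval_zero_eq_one {n : ℕ} (hn : 1 ≤ n) (d : ℕ) :
    ∃ P : Polynomial ℝ, P.natDegree ≤ d ∧ P.eval 0 = 1 ∧
      ∀ j : ℕ, 1 ≤ j → j ≤ n → |P.eval (j : ℝ)| ≤ 2 * Real.exp (-(d / Real.sqrt n)) := by
  have hnR : (1 : ℝ) ≤ n := by exact_mod_cast hn
  set θ : ℝ := 1 / Real.sqrt n with hθ
  have hθ2 : θ ^ 2 = 1 / n := by rw [hθ, div_pow, one_pow, Real.sq_sqrt (by linarith)]
  set s : ℝ := Real.cosh θ - 1 with hs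
  have hs0 : 0 ≤ s := sub_nonneg.2 (Real.one_le_cosh θ)
  have hsn : n * s ≤ 1 := by
    have hu : θ ^ 2 / 2 ≤ 1 / 2 := by
      rw [hθ2]
      have : (1 : ℝ) / n ≤ 1 := by rw [div_le_one (by linarith)]; exact hnR
      linarith
    have h1 : Real.exp (θ ^ 2 / 2) ≤ 1 + θ ^ 2 := by
      have h2 := Real.add_one_le_exp (-(θ ^ 2 / 2))
      have h3 : Real.exp (θ ^ 2 / 2) * Real.exp (-(θ ^ 2 / 2)) = 1 := by
        rw [← Real.exp_add]; simp
      have h4 := Real.exp_pos (θ ^ 2 / 2)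
      have h5 := sq_nonneg θ
      nlinarith [mul_le_mul_of_nonneg_left h2 h4.le]
    have h6 : s ≤ 1 / n := by
      have := Real.cosh_le_exp_half_sq θ
      rw [← hθ2]; linarith
    calc n * s ≤ n * (1 / n) := by gcongr
      _ = 1 := by field_simp
  have hcosh : Real.exp (d / Real.sqrt n) / 2 ≤ Real.cosh (d * θ) := by
    have h : d / Real.sqrt n = d * θ := by rw [hθ]; ring
    rw [h, Real.cosh_eq]
    have := Real.exp_pos (-(d * θ))
    linarith
  have hcosh0 : 0 < Real.cosh (d * θ) := Real.cosh_pos _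
  refine ⟨Polynomial.C (Real.cosh (d * θ))⁻¹ * (Polynomial.Chebyshev.T ℝ d).comp
    (Polynomial.C (Real.cosh θ) - Polynomial.C s * Polynomial.X), ?_, ?_, fun j hj1 hjn => ?_⟩
  · refine (Polynomial.natDegree_C_mul_le _ _).trans (Polynomial.natDegree_comp_le.trans ?_)
    have h1 : (Polynomial.Chebyshev.T ℝ d).natDegree = d := by simp
    have h2 : (Polynomial.C (Real.cosh θ) - Polynomial.C s * Polynomial.X).natDegree ≤ 1 := by
      compute_degree
    rw [h1]
    nlinarith
  · have h := Polynomial.Chebyshev.T_real_cosh θ d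
    push_cast at h
    simp [h, hcosh0.ne']
  · have hjR : (1 : ℝ) ≤ j := by exact_mod_cast hj1
    have hjnR : (j : ℝ) ≤ n := by exact_mod_cast hjn
    have h1 : |Real.cosh θ - s * j| ≤ 1 := by
      have h2 : s * j ≤ n * s := by rw [mul_comm]; gcongr
      have h3 : s ≤ s * j := le_mul_of_one_le_right hs0 hjR
      rw [abs_le]
      constructor <;> linarith [Real.one_le_cosh θ]
    have h2 := Polynomial.Chebyshev.abs_eval_T_real_le_one d h1
    have h3 : |(Polynomial.C (Real.cosh (d * θ))⁻¹ * (Polynomial.Chebyshev.T ℝ d).comp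
        (Polynomial.C (Real.cosh θ) - Polynomial.C s * Polynomial.X)).eval (j : ℝ)|
        = (Real.cosh (d * θ))⁻¹ *
          |(Polynomial.Chebyshev.T ℝ d).eval (Real.cosh θ - s * j)| := by
      simp [abs_mul, abs_of_pos hcosh0]
    rw [h3]
    calc _ ≤ (Real.exp (d / Real.sqrt n) / 2)⁻¹ * 1 := by gcongr
      _ = 2 * Real.exp (-(d / Real.sqrt n)) := by
        rw [Real.exp_neg]; field_simp

/-! ### Product states -/

section Tensor

variable {n : ℕ}

/-- The tensor product of one-qubit operators. -/
def tensor (A : Fin n → Matrix (Fin 2) (Fin 2) ℂ) : Op n :=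
  Matrix.of fun x y => ∏ i, A i (x i) (y i)

theorem tensor_mul_tensor (A B : Fin n → Matrix (Fin 2) (Fin 2) ℂ) :
    tensor A * tensor B = tensor fun i => A i * B i := by
  ext x y
  simp only [tensor, Matrix.mul_apply, Matrix.of_apply, Finset.prod_univ_sum,
    Fintype.piFinset_univ, Finset.prod_mul_distrib]

theorem conjTranspose_tensor (A : Fin n → Matrix (Fin 2) (Fin 2) ℂ) :
    (tensor A)ᴴ = tensor fun i => (A i)ᴴ := by
  ext x y
  simp [tensor, Matrix.conjTranspose_apply]

theorem tensor_diagonal (v : Fin n → Fin 2 → ℂ) :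
    tensor (fun i => Matrix.diagonal (v i)) = Matrix.diagonal fun x => ∏ i, v i (x i) := by
  ext x y
  rw [tensor, Matrix.of_apply]
  by_cases h : x = y
  · simp [h]
  · obtain ⟨i, hi⟩ := Function.ne_iff.1 h
    rw [Matrix.diagonal_apply_ne _ h]
    exact Finset.prod_eq_zero (Finset.mem_univ i) (Matrix.diagonal_apply_ne _ hi)

theorem tensor_one : tensor (fun _ : Fin n => (1 : Matrix (Fin 2) (Fin 2) ℂ)) = 1 := by
  have h := tensor_diagonal (fun (_ : Fin n) (_ : Fin 2) => (1 : ℂ))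
  simpa using h

theorem actsTriviallyOn_tensor {A : Fin n → Matrix (Fin 2) (Fin 2) ℂ} {q : Fin n}
    (hq : A q = 1) : ActsTriviallyOn (tensor A) q := by
  refine actsTriviallyOn_iff.2 ⟨fun x y h => ?_, fun x y c h => ?_⟩
  · exact Finset.prod_eq_zero (Finset.mem_univ q) (by rw [hq, Matrix.one_apply_ne h])
  · rw [tensor, Matrix.of_apply, Matrix.of_apply]
    refine Finset.prod_congr rfl fun i _ => ?_
    by_cases hi : i = q
    · subst hi; simp [hq, h]
    · simp [hi]

/-- The number of ones of a computational basis label. -/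
def weight (x : Basis n) : ℕ := ∑ i, (x i : ℕ)

theorem weight_le (x : Basis n) : weight x ≤ n := by
  calc weight x ≤ ∑ _i : Fin n, 1 := Finset.sum_le_sum fun i _ => by lia
    _ = n := by simp

/-- The sum of one-qubit operators with diagonal `(0, 1)`, written in a product basis, is
`1`-local. -/
theorem isLocal_tensor_conj_weight {W : Fin n → Matrix (Fin 2) (Fin 2) ℂ}
    (hW : ∀ i, W i * (W i)ᴴ = 1) :
    IsLocal 1 (tensor W * Matrix.diagonal (fun x => (weight x : ℂ)) * (tensor W)ᴴ) := by
  have hsum : Matrix.diagonal (fun x : Basis n => (weight x : ℂ)) =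
      ∑ i, tensor fun j => Matrix.diagonal fun a : Fin 2 =>
        if j = i then ((a : ℕ) : ℂ) else 1 := by
    simp only [tensor_diagonal]
    rw [← Matrix.diagonalAddMonoidHom_apply]
    simp_rw [← Matrix.diagonalAddMonoidHom_apply]
    rw [← map_sum]
    congr 1
    funext x
    simp [weight]
  rw [hsum, Finset.mul_sum, Finset.sum_mul]
  refine .sum fun i _ => .of_card_le ?_
  rw [conjTranspose_tensor, tensor_mul_tensor, tensor_mul_tensor]
  refine (Finset.card_le_card (t := {i}) (qubitSupport_subset_iff.2 fun q hq => ?_)).trans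
    (Finset.card_singleton i).le
  refine actsTriviallyOn_tensor ?_
  rw [Finset.mem_singleton] at hq
  simp [hq, hW]

/-- A one-qubit unitary whose first column is the unit vector `v`. -/
noncomputable def frame (v : EuclideanSpace ℂ (Fin 2)) : Matrix (Fin 2) (Fin 2) ℂ :=
  !![v 0, -star (v 1); v 1, star (v 0)]

theorem frame_mul_conjTranspose {v : EuclideanSpace ℂ (Fin 2)} (hv : ‖v‖ = 1) :
    frame v * (frame v)ᴴ = 1 := by
  have h : v 0 * star (v 0) + v 1 * star (v 1) = 1 := by
    have h1 : ‖v 0‖ ^ 2 + ‖v 1‖ ^ 2 = 1 := by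
      have := EuclideanSpace.norm_sq_eq v
      rw [hv, Fin.sum_univ_two] at this
      linarith
    simp only [Complex.star_def, Complex.mul_conj']
    exact_mod_cast h1
  ext i j
  fin_cases i <;> fin_cases j <;>
    simp only [frame, Matrix.mul_apply, Matrix.conjTranspose_apply, Fin.sum_univ_two] <;>
    simp at h ⊢
  · linear_combination h
  · ring
  · ring
  · linear_combination h

/-- In a product basis adapted to it, a pure product state is the projector onto weight zero. -/
theorem IsPureProductState.exists_eq {ρ : Op n} (hρ : IsPureProductState ρ) :
    ∃ W : Fin n → Matrix (Fin 2) (Fin 2) ℂ, (∀ i, W i * (W i)ᴴ = 1) ∧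
      ρ = tensor W * Matrix.diagonal (fun x => if weight x = 0 then 1 else 0) * (tensor W)ᴴ := by
  obtain ⟨φ, hφ, hρ⟩ := hρ
  refine ⟨fun i => frame (φ i), fun i => frame_mul_conjTranspose (hφ i), ?_⟩
  ext x y
  have hcol (x : Basis n) : tensor (fun i => frame (φ i)) x 0 = ∏ i, φ i (x i) := by
    rw [tensor, Matrix.of_apply]
    refine Finset.prod_congr rfl fun i _ => ?_
    generalize x i = a
    fin_cases a <;> simp [frame]
  rw [hρ, Matrix.mul_apply, Finset.sum_eq_single 0]
  · rw [Matrix.mul_diagonal, Matrix.conjTranspose_apply, hcol, hcol]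
    simp [weight]
  · intro z _ hz
    have hw : weight z ≠ 0 := fun h => hz (funext fun i => by
      have := (Finset.sum_eq_zero_iff.1 h) i (Finset.mem_univ i)
      exact Fin.ext this)
    rw [Matrix.mul_diagonal, if_neg hw, mul_zero, zero_mul]
  · simp

theorem tensor_mem_unitary {W : Fin n → Matrix (Fin 2) (Fin 2) ℂ}
    (hW : ∀ i, W i * (W i)ᴴ = 1) : tensor W ∈ unitary (Op n) := by
  have h : tensor W * (tensor W)ᴴ = 1 := by
    rw [conjTranspose_tensor, tensor_mul_tensor]
    simp only [hW, tensor_one]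
  exact Unitary.mem_iff.2 ⟨mul_eq_one_comm.1 h, h⟩

theorem norm_conj_diagonal_le {U : Op n} (hU : U ∈ unitary (Op n)) {v : Basis n → ℂ} {r : ℝ}
    (hr : 0 ≤ r) (hv : ∀ x, ‖v x‖ ≤ r) : ‖U * Matrix.diagonal v * Uᴴ‖ ≤ r := by
  rw [← Matrix.star_eq_conjTranspose, CStarRing.norm_mul_mem_unitary _ (Unitary.star_mem hU),
    CStarRing.norm_mem_unitary_mul _ hU, Matrix.l2_opNorm_diagonal]
  exact (pi_norm_le_iff_of_nonneg hr).2 hv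

theorem IsPureProductState.norm_le_one {ρ : Op n} (hρ : IsPureProductState ρ) : ‖ρ‖ ≤ 1 := by
  obtain ⟨W, hW, rfl⟩ := hρ.exists_eq
  refine norm_conj_diagonal_le (tensor_mem_unitary hW) zero_le_one fun x => ?_
  split_ifs <;> simp

theorem conj_pow_of_mem_unitary {U : Op n} (hU : U ∈ unitary (Op n)) (A : Op n) (m : ℕ) :
    (U * A * Uᴴ) ^ m = U * A ^ m * Uᴴ := by
  have h1 : Uᴴ * U = 1 := (Unitary.mem_iff.1 hU).1
  have h2 : U * Uᴴ = 1 := (Unitary.mem_iff.1 hU).2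
  induction m with
  | zero => simp [h2]
  | succ m ih =>
    rw [pow_succ, ih, pow_succ]
    calc U * A ^ m * Uᴴ * (U * A * Uᴴ) = U * A ^ m * (Uᴴ * U) * A * Uᴴ := by
          simp only [mul_assoc]
      _ = _ := by rw [h1, mul_one]; simp only [mul_assoc]

/-- Applying the Chebyshev approximation to the weight operator of an adapted product basis. -/
theorem IsPureProductState.isApproxLocal {ρ : Op n} (hρ : IsPureProductState ρ) (hn : 1 ≤ n)
    (d : ℕ) : IsApproxLocal d (2 * Real.exp (-(d / Real.sqrt n))) ρ := by
  obtain ⟨W, hW, rfl⟩ := hρ.exists_eq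
  obtain ⟨P, hdeg, hP0, hP⟩ := exists_polynomial_eval_zero_eq_one hn d
  have hU := tensor_mem_unitary hW
  refine ⟨∑ m ∈ Finset.range (d + 1), (P.coeff m : ℂ) •
    (tensor W * Matrix.diagonal (fun x => (weight x : ℂ)) * (tensor W)ᴴ) ^ m,
    .sum fun m hm => .smul _ (.mono (Nat.lt_succ_iff.1 (Finset.mem_range.1 hm)) ?_), ?_⟩
  · simpa using (isLocal_tensor_conj_weight hW).pow m
  · have hpoly : ∑ m ∈ Finset.range (d + 1), (P.coeff m : ℂ) •
        (tensor W * Matrix.diagonal (fun x => (weight x : ℂ)) * (tensor W)ᴴ) ^ m =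
        tensor W * Matrix.diagonal (fun x => ((P.eval (weight x : ℝ) : ℝ) : ℂ)) *
          (tensor W)ᴴ := by
      have hdiag : Matrix.diagonal (fun x : Basis n => ((P.eval (weight x : ℝ) : ℝ) : ℂ)) =
          ∑ m ∈ Finset.range (d + 1),
            (P.coeff m : ℂ) • Matrix.diagonal (fun x => (weight x : ℂ)) ^ m := by
        ext x y
        rw [Matrix.sum_apply]
        by_cases hxy : x = y
        · simp [hxy, Matrix.diagonal_pow, Polynomial.eval_eq_sum_range' (Nat.lt_succ_of_le hdeg)]
        · simp [hxy, Matrix.diagonal_pow]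
      rw [hdiag, Finset.mul_sum, Finset.sum_mul]
      refine Finset.sum_congr rfl fun m _ => ?_
      rw [conj_pow_of_mem_unitary hU, Matrix.mul_smul, Matrix.smul_mul]
    rw [hpoly, ← sub_mul, ← mul_sub, Matrix.diagonal_sub]
    refine norm_conj_diagonal_le hU (by positivity) fun x => ?_
    split_ifs with hx
    · simp only [hx, Nat.cast_zero, hP0, Complex.ofReal_one, sub_self, norm_zero]
      positivity
    · rw [zero_sub, norm_neg, Complex.norm_real, Real.norm_eq_abs]
      exact hP _ (Nat.one_le_iff_ne_zero.2 hx) (weight_le x)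

end Tensor

/-! ### Asymptotics of the error -/

/-- The error of the initial Chebyshev approximation plus that of at most `n` evolution steps. -/
theorem error_le {n p : ℕ} (hn : 4 ^ 8 ≤ n) (hp : p ≤ n) :
    2 * Real.exp (-((⌊(n : ℝ) ^ (3 / 4 : ℝ)⌋₊ : ℝ) / Real.sqrt n)) +
        2 * p * Real.exp (-(n : ℝ) ^ (3 / 4 : ℝ))
      ≤ 4 * Real.exp (-(n : ℝ) ^ (1 / 8 : ℝ) / Real.sqrt 2) ∧
    4 * Real.exp (-(n : ℝ) ^ (1 / 8 : ℝ) / Real.sqrt 2) ≤ 1 := by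
  have hnR : (4 : ℝ) ^ 8 ≤ n := by exact_mod_cast hn
  have hn0 : (0 : ℝ) < n := by linarith [show (0 : ℝ) < 4 ^ 8 by norm_num]
  set t : ℝ := (n : ℝ) ^ (1 / 8 : ℝ) with ht
  have ht8 : t ^ 8 = n := by
    rw [ht, ← Real.rpow_mul_natCast hn0.le]; norm_num
  have ht6 : (n : ℝ) ^ (3 / 4 : ℝ) = t ^ 6 := by
    rw [ht, ← Real.rpow_mul_natCast hn0.le]; norm_num
  have ht0 : 0 < t := Real.rpow_pos_of_pos hn0 _
  have ht4 : Real.sqrt n = t ^ 4 := by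
    rw [← ht8, show t ^ 8 = (t ^ 4) ^ 2 by ring, Real.sqrt_sq (by positivity)]
  have h4t : 4 ≤ t := by
    refine le_of_pow_le_pow_left₀ (n := 8) (by norm_num) ht0.le ?_
    rw [ht8]; exact hnR
  have hsqrt1 : 1 ≤ Real.sqrt 2 := Real.one_le_sqrt.2 (by norm_num)
  have hsqrt2 : Real.sqrt 2 ≤ 2 := Real.sqrt_le_iff.2 ⟨by norm_num, by norm_num⟩
  have hle : t / Real.sqrt 2 ≤ t := div_le_self ht0.le hsqrt1
  refine ⟨?_, ?_⟩
  · have h1 : Real.exp (-((⌊(n : ℝ) ^ (3 / 4 : ℝ)⌋₊ : ℝ) / Real.sqrt n))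
        ≤ Real.exp (-t / Real.sqrt 2) := by
      rw [neg_div]
      refine Real.exp_le_exp.2 (neg_le_neg (hle.trans ?_))
      rw [ht4, ht6, le_div_iff₀ (by positivity)]
      have h2 := (Nat.lt_floor_add_one (t ^ 6)).le
      have h3 : (1 : ℝ) ≤ t ^ 5 := one_le_pow₀ (by linarith)
      have h5 : 4 * t ^ 5 ≤ t * t ^ 5 := by gcongr
      nlinarith
    have h2 : (p : ℝ) * Real.exp (-(n : ℝ) ^ (3 / 4 : ℝ)) ≤ Real.exp (-t / Real.sqrt 2) := by
      have hpn : (p : ℝ) ≤ Real.exp (8 * t) := by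
        calc (p : ℝ) ≤ n := by exact_mod_cast hp
          _ = t ^ 8 := ht8.symm
          _ ≤ Real.exp t ^ 8 := by
            gcongr
            linarith [Real.add_one_le_exp t]
          _ = Real.exp (8 * t) := by rw [← Real.exp_nat_mul]; norm_num
      calc _ ≤ Real.exp (8 * t) * Real.exp (-t ^ 6) := by rw [ht6]; gcongr
        _ = Real.exp (8 * t - t ^ 6) := by rw [← Real.exp_add]; ring_nf
        _ ≤ _ := by
          refine Real.exp_le_exp.2 ?_
          rw [neg_div]
          have h3 : (4 : ℝ) ^ 5 ≤ t ^ 5 := by gcongr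
          have h5 : t * 4 ^ 5 ≤ t * t ^ 5 := by gcongr
          nlinarith
    linarith
  · have h1 : 2 ≤ t / Real.sqrt 2 := by
      rw [le_div_iff₀ (by linarith)]
      linarith
    have h2 : Real.exp (-t / Real.sqrt 2) ≤ Real.exp (-2) := by
      rw [neg_div]
      exact Real.exp_le_exp.2 (neg_le_neg h1)
    have h3 : (4 : ℝ) ≤ Real.exp 2 := by
      have h4 := Real.add_one_le_exp (1 : ℝ)
      rw [show (2 : ℝ) = 1 + 1 by norm_num, Real.exp_add]
      nlinarith
    rw [Real.exp_neg] at h2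
    calc 4 * Real.exp (-t / Real.sqrt 2) ≤ 4 * (Real.exp 2)⁻¹ := by gcongr
      _ ≤ 1 := by
        rw [← div_eq_mul_inv, div_le_one (Real.exp_pos 2)]
        exact h3

end DenseEvolution

theorem theorem4p1 (ℓ : ℕ) (C : ℝ) (hC : 0 < C) :
    ∃ c₁ : ℝ, 0 < c₁ ∧
      ∀ α : ℝ, 0 ≤ α → α < 1 →
      ∀ p : ℕ → ℕ, (fun n => (p n : ℝ)) =o[atTop] (fun n : ℕ => Real.log (n : ℝ)) →
      ∀ᶠ n : ℕ in atTop,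
        ∀ (H : Fin (p n) → DenseEvolution.CommutingLocalHamiltonian n ℓ)
          (ρ₀ : DenseEvolution.Op n),
          (∀ i, (H i).NormConstraint α C) →
          DenseEvolution.IsPureProductState ρ₀ →
          ∃ (k : ℕ) (ε : ℝ),
            (k : ℝ) ≤ c₁ ^ (p n) * (n : ℝ) ^ (1 - (1 - α) ^ (p n) / 4) ∧
            0 < ε ∧ ε ≤ 4 * Real.exp (-(n : ℝ) ^ (1 / 8 : ℝ) / Real.sqrt 2) ∧
            DenseEvolution.IsApproxLocal k ε (DenseEvolution.outputState H ρ₀) := by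
  refine ⟨1 + (2 * Real.exp 2 * C + 2) * ℓ, by positivity, fun α hα0 hα1 p hp => ?_⟩
  filter_upwards [hp.bound one_pos, eventually_ge_atTop (4 ^ 8)] with n hpn hn H ρ₀ hH hρ
  have hn1 : 1 ≤ n := le_trans (by norm_num) hn
  have hpn' : p n ≤ n := by
    have hnR : (1 : ℝ) ≤ n := by exact_mod_cast hn1
    rw [one_mul, Real.norm_natCast, Real.norm_of_nonneg (Real.log_nonneg hnR)] at hpn
    exact_mod_cast hpn.trans (Real.log_le_self (by linarith))
  obtain ⟨hε, hε1⟩ := DenseEvolution.error_le hn hpn'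
  obtain ⟨k, hk, hloc⟩ := DenseEvolution.exists_isApproxLocal_outputState hn1 hα0 hα1.le hC.le
    (Nat.floor_le (by positivity)) (hρ.isApproxLocal hn1 _) hρ.norm_le_one H hH (hε.trans hε1)
  exact ⟨k, _, hk, by positivity, hε, hloc⟩
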